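/- Let $B,T,B_2$ be integers with $1\le B\le T$, let $\alpha=a/b>1$ be a rational number in lowest terms ($a,b$ positive integers), and suppose $B_2=\alpha B$. Definitions. A streaming code with finite source alphabet $S$ and channel alphabet $X$ is a sequence of maps $x[t]=f_t(s[0],\dots,s[t])\in X$, $t\ge 0$. It achieves delay $T'$ for bursts of length $B'$ if there are functions $\gamma_t$ such that, for every source sequence $s$, every $j\ge 0$ and every $t\ge 0$, $\gamma_t(y[0],\dots,y[t+T'])=s[t]$, where $y[i]=\star$ for $j\le i\le j+B'-1$ and $y[i]=x[i]$ otherwise. Its rate is $H(s)/H(x)$ for an i.i.d. source uniform on $S$, where $H(x)$ is the marginal entropy of a channel symbol $x[t]$ after an initial transient (and $H(x[t])\le H(x)$ for all $t$). A $\{(B_1,T_1),(B_2,T_2)\}$ DE-SCo, $B_1<B_2$, is a streaming code of rate $T_1/(T_1+B_1)$ that achieves delay $T_1$ for bursts of length $B_1$ (user 1) and delay $T_2$ for bursts of length $B_2$ (user 2). The code $\mathcal D_{a,b}(H)$. Let $B_0\geq 1$, $T_0\ge B_0$ and let $H=(H_{jk})$ be a $(T_0-B_0)\times B_0$ matrix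 over a finite field $\mathbb F$ such that the code with generator matrix $[\,I\mid H\,]$ corrects all erasure bursts of length $B_0$, including end-around bursts. Let $V\neq 0$ be a finite vector space over $\mathbb F$. For $v\in V^{T_0}$ and $0\le k<B_0$ put $r_k(v)=v_k+\sum_{j} H_{jk}v_{B_0+j}$. The source symbols are $s[i]=(s_0[i],\dots,s_{T_0-1}[i])\in V^{T_0}$ ($s[i]=0$ for $i<0$), $\ell=a-b$, and for $0\le k<B_0$ $$p^{\mathrm I}_k[i]=r_k\big(s_m[i-bT_0-kb+mb]\big)_{0\le m<T_0},$$ $$p^{\mathrm{II}}_k[i]=r_k\big(s_{T_0-1-m}[i-\ell-k\ell-\ell(T_0-1-m)]\big)_{0\le m<T_0},$$ so that $p^{\mathrm I}$ uses the main diagonal with interleaving step $b$ and $p^{\mathrm{II}}$ the opposite diagonal with interleaving step $a-b$. The channel symbol is $x[i]=(s[i],q[i])$ with $q[i]=p^{\mathrm I}[i]+p^{\mathrm{II}}[i-b(T_0+B_0)]$. Claim. 1. There is a $\{(B,T),(\alpha B,\lceil\alpha T+B\rceil)\}$ DE-SCo; its rate is $T/(T+B)$. 2. If $\alpha T$ is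 an integer, then $B_0=B/b$ and $T_0=T/b$ are integers, matrices $H$ as above exist over some finite field, and for every finite field $\mathbb F$, every finite $V\ne0$ and every such $H$ the code $\mathcal D_{a,b}(H)$ is a $\{(B,T),(\alpha B,\alpha T+B)\}$ DE-SCo. 3. In general, let $n$ be the smallest positive integer such that $n\alpha T$ is an integer. Then $B_0=nB/b$ and $T_0=nT/b$ are integers, matrices $H$ as above exist over some finite field, and for every finite field $\mathbb F$, every finite $V\ne0$ and every such $H$ the following source pseudo-expansion of $\mathcal D_{a,b}(H)$ is a $\{(B,T),(\alpha B,\lceil\alpha T+B\rceil)\}$ DE-SCo: split each source symbol as $s[i]=(\tilde s[ni],\dots,\tilde s[ni+n-1])$ with $\tilde s[\cdot]\in V^{T_0}$, apply $\mathcal D_{a,b}(H)$ to the stream $\tilde s$ to get $\tilde x$, and send $x[i]=(\tilde x[ni],\dots,\tilde x[ni+n-1])$. -/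

import Mathlib

universe u v

noncomputable section

/-- A causal streaming encoder with source alphabet `S` and channel alphabet `X`: the channel
symbol at time `t` is a function `f_t (s[0], …, s[t])`. -/
def StreamingCode (S X : Type*) := (t : ℕ) → (Fin (t + 1) → S) → X

namespace StreamingCode

/-- The channel symbol `x[t]` produced from the source stream `s`. -/
def output {S X : Type*} (c : StreamingCode S X) (s : ℕ → S) (t : ℕ) : X :=
  c t (fun i => s i)

/-- The channel output at time `t` when the symbols at times `j, …, j + B - 1` are erased
(`none` is the erasure symbol). -/
def received {S X : Type*} (c : StreamingCode S X) (B j : ℕ) (s : ℕ → S) (t : ℕ) : Option X :=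
  if j ≤ t ∧ t < j + B then none else some (c.output s t)

/-- There are decoding functions `γ_t` which, whatever the position `j` of a single erasure burst
of length `B`, recover every source symbol `s[t]` from the channel outputs at times
`0, …, t + T`. -/
def AchievesDelay {S X : Type*} (c : StreamingCode S X) (B T : ℕ) : Prop :=
  ∃ γ : (t : ℕ) → (Fin (t + T + 1) → Option X) → S,
    ∀ (j : ℕ) (s : ℕ → S) (t : ℕ), γ t (fun i => c.received B j s i) = s t

end StreamingCode

/-- Shannon entropy (in nats) of a law on a finite alphabet. -/
def shannonEntropy {X : Type*} [Fintype X] (p : PMF X) : ℝ :=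
  ∑ x, Real.negMulLog (p x).toReal

namespace StreamingCode

/-- Entropy of a source symbol; the source is i.i.d. uniform on `S`. -/
def sourceEntropy (S : Type*) [Fintype S] [Nonempty S] : ℝ :=
  shannonEntropy (PMF.uniformOfFintype S)

/-- Marginal entropy of the channel symbol `x[t]` when the source is i.i.d. uniform on `S`. -/
def channelEntropy {S X : Type*} [Fintype S] [Nonempty S] [Fintype X]
    (c : StreamingCode S X) (t : ℕ) : ℝ :=
  shannonEntropy ((PMF.uniformOfFintype (Fin (t + 1) → S)).map (c t))

/-- The code has rate `R = H(s) / H(x)`: the ratio is `R` at all times after an initial transient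
(before which `x[t]` depends on source symbols of negative time, which are zero), and the
marginal entropy of no channel symbol ever exceeds `H(s) / R`. -/
def HasRate {S X : Type*} [Fintype S] [Nonempty S] [Fintype X]
    (c : StreamingCode S X) (R : ℝ) : Prop :=
  (∀ᶠ t in Filter.atTop, sourceEntropy S / c.channelEntropy t = R) ∧
    ∀ t, R * c.channelEntropy t ≤ sourceEntropy S

/-- Diversity embedded streaming erasure code with parameters `{(B₁, T₁), (B₂, T₂)}`. -/
def IsDESCo {S X : Type*} [Fintype S] [Nonempty S] [Fintype X]
    (c : StreamingCode S X) (B₁ T₁ B₂ T₂ : ℕ) : Prop :=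
  B₁ < B₂ ∧ c.HasRate ((T₁ : ℝ) / ((T₁ : ℝ) + (B₁ : ℝ))) ∧
    c.AchievesDelay B₁ T₁ ∧ c.AchievesDelay B₂ T₂

end StreamingCode

/-- The systematic code of length `K + B` and dimension `K` with generator matrix `[I | H]`
corrects every erasure burst of length `B`, end-around bursts included: a message is determined
by the coordinates of its codeword outside the cyclic burst `j, j + 1, …, j + B - 1` modulo
`K + B`. -/
def IsBEBC {F : Type*} [Field F] {K B : ℕ} (H : Matrix (Fin K) (Fin B) F) : Prop :=
  ∀ (j : Fin (K + B)) (m m' : Fin K → F),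
    (∀ i : Fin (K + B), B ≤ ((i : ℕ) + (K + B) - (j : ℕ)) % (K + B) →
      Fin.append m (Matrix.vecMul m H) i = Fin.append m' (Matrix.vecMul m' H) i) → m = m'

/-- The parity checks `r = u + n H` of the low-delay burst erasure block code, for the information
vector `v = (u, n)` with urgent part `u` of length `B` and non-urgent part `n` of length `K`.
The sub-symbols lie in a vector space `V` over `F`. -/
def ldParity {F V : Type*} [Field F] [AddCommGroup V] [Module F V] {B K : ℕ}
    (H : Matrix (Fin K) (Fin B) F) (v : Fin (B + K) → V) (k : Fin B) : V :=
  v (Fin.castAdd K k) + ∑ j : Fin K, H j k • v (Fin.natAdd B j)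

/-- The source symbol at time `z`, given the symbols `s[0], …, s[t]`; zero at the times outside
`0, …, t`. -/
def symbolAt {A : Type*} [Zero A] {t : ℕ} (s : Fin (t + 1) → A) (z : ℤ) : A :=
  if h : 0 ≤ z ∧ z ≤ t then s ⟨z.toNat, by omega⟩ else 0

/-- Parity check `p_k[i]` of the streaming code with interleaving step `b` along the main diagonal:
the LD-BEBC parity check `k` of the diagonal vector
`(s_0[τ], s_1[τ + b], …, s_{T-1}[τ + (T-1) b])` with `τ = i - b T - k b`, where `T = B + K`. -/
def mainParity {F V : Type*} [Field F] [AddCommGroup V] [Module F V] {B K : ℕ}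
    (H : Matrix (Fin K) (Fin B) F) (b : ℕ) (s : ℤ → Fin (B + K) → V) (k : Fin B) (i : ℤ) : V :=
  ldParity H (fun m => s (i - b * (B + K) - (k : ℕ) * b + (m : ℕ) * b) m) k

/-- Parity check `p_k[i]` of the streaming code with interleaving step `l` along the opposite
diagonal: the LD-BEBC parity check `k` of the diagonal vector
`(s_{T-1}[τ - l (T-1)], …, s_1[τ - l], s_0[τ])` with `τ = i - l - k l`, where `T = B + K`. -/
def offParity {F V : Type*} [Field F] [AddCommGroup V] [Module F V] {B K : ℕ}
    (H : Matrix (Fin K) (Fin B) F) (l : ℕ) (s : ℤ → Fin (B + K) → V) (k : Fin B) (i : ℤ) : V :=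
  ldParity H (fun m => s (i - l - (k : ℕ) * l - l * (m.rev : ℕ)) m.rev) k

/-- The DE-SCo construction with interleaving step `b` for the first code and `a - b` for the
second one, for `B₀` parity sub-symbols and `T₀ = B₀ + K` source sub-symbols (in `V`) per time
step: `x[i] = (s[i], q[i])`, where `q[i] = pI[i] + pII[i - Δ]` and `Δ = b (T₀ + B₀)`. -/
def desco {F V : Type*} [Field F] [AddCommGroup V] [Module F V] {B₀ K : ℕ}
    (H : Matrix (Fin K) (Fin B₀) F) (a b : ℕ) :
    StreamingCode (Fin (B₀ + K) → V) ((Fin (B₀ + K) → V) × (Fin B₀ → V)) :=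
  fun t s =>
    (s (Fin.last t), fun k =>
      mainParity H b (symbolAt s) k t +
        offParity H (a - b) (symbolAt s) k (t - b * ((B₀ + K) + B₀)))

/-- Source pseudo-expansion: each source symbol `s[i]` is split into `n` symbols
`s̃[n i + r]`, `r = 0, …, n - 1`, the code `c` is applied to the expanded stream `s̃`, and the
channel symbol at time `i` consists of the `n` symbols of `c` at times `n i, …, n i + n - 1`. -/
def pseudoExpand {S X : Type*} (n : ℕ) (c : StreamingCode S X) :
    StreamingCode (Fin n → S) (Fin n → X) :=
  fun t s r => c (n * t + r) fun i =>
    s ⟨(i : ℕ) / n, Nat.div_lt_of_lt_mul (by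
        have h1 := i.isLt
        have h2 := r.isLt
        rw [Nat.mul_add, Nat.mul_one]
        omega)⟩
      ⟨(i : ℕ) % n, Nat.mod_lt _ r.pos⟩

end

/-! Write `B` for B₀ and `K` for T₀ - B₀. The code is linear, systematic and time invariant, so
decoding reduces to one claim: if the stream vanishes before time 0, and the symbols and parities
received between the end of the burst and the deadline vanish, then `s 0 = 0`.

User 1: before the deadline the delayed pII involves only times before the burst, so q = pI. A burst
of b`B` times meets each main diagonal in `B` consecutive entries, and the block code recovers the
first of them in time (`mainParity_user_one`).

User 2: write a = b + l. For l`B` ≤ i ≤ l(`B`+`K`), the pI added to pII[i] involves only symbols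
after the burst, so pII[i] is known. These checks would handle a burst of length l`B`, but the
erasures continue for b`B` more times. The extra erased entries on the diagonal of a symbol at time
0 are all non-urgent (`m < K`). They are recovered by induction on the opposite diagonals z + ml:
those with z ≥ l`B` from main diagonals, whose earlier entries lie on smaller opposite diagonals,
and then those with z < l`B` from the opposite diagonal itself (`BurstKernel.nonurgent_eq_zero`).

Rate: every channel symbol is eventually attained, so additivity makes the output uniform.
Reed–Solomon codes supply `H`, and pseudo-expansion by `n` clears the denominator of αT. -/

/-! ### Burst erasures in the low-delay block code -/

section BlockCode

variable {F V : Type*} [Field F] [AddCommGroup V] [Module F V] {B K : ℕ}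
  {H : Matrix (Fin K) (Fin B) F}

theorem ldParity_add (H : Matrix (Fin K) (Fin B) F) (v w : Fin (B + K) → V) (k : Fin B) :
    ldParity H (fun m => v m + w m) k = ldParity H v k + ldParity H w k := by
  simp only [ldParity, smul_add, Finset.sum_add_distrib]
  abel

theorem ldParity_eq_zero (H : Matrix (Fin K) (Fin B) F) {v : Fin (B + K) → V} {k : Fin B}
    (hu : v (Fin.castAdd K k) = 0) (hn : ∀ j, v (Fin.natAdd B j) = 0) : ldParity H v k = 0 := by
  simp [ldParity, hu, hn]

/-- A message of a burst erasure block code vanishes if its codeword vanishes on a cyclic interval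
of `K` coordinates starting at `μ % (K + B)`. -/
theorem IsBEBC.eq_zero (hH : IsBEBC H) {μ : ℕ} (hμ : μ < B + K) {n : Fin K → F}
    (hn : ∀ j : Fin K, B + j < μ ∨ μ ≤ j → n j = 0)
    (hc : ∀ k : Fin B, (k : ℕ) < μ → μ ≤ K + k → ∑ j, H j k * n j = 0) : n = 0 := by
  -- `J` is μ + K modulo K + B: the burst starting there is the complement of the known cyclic
  -- interval of K coordinates starting at μ.
  have key : ∀ J : Fin (K + B), (J : ℕ) = (if μ < B then μ + K else μ - B) → n = 0 := by
    intro J hJ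
    refine hH J n 0 fun i hi => ?_
    rw [Matrix.zero_vecMul]
    have hmod : ((i : ℕ) + (K + B) - (J : ℕ)) % (K + B) =
        if (J : ℕ) ≤ i then (i : ℕ) - J else (i : ℕ) + (K + B) - J := by
      split_ifs with h
      · rw [show (i : ℕ) + (K + B) - J = (i - J : ℕ) + (K + B) by omega, Nat.add_mod_right]
        exact Nat.mod_eq_of_lt (by omega)
      · exact Nat.mod_eq_of_lt (by omega)
    rw [hmod] at hi
    induction i using Fin.addCases with
    | left j =>
      simp only [Fin.append_left, Pi.zero_apply]
      apply hn
      simp only [Fin.val_castAdd] at hi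
      split_ifs at hi hJ <;> omega
    | right k =>
      simp only [Fin.append_right, Pi.zero_apply]
      simp only [Matrix.vecMul, dotProduct]
      simp only [Fin.val_natAdd] at hi
      have hk := k.isLt
      rw [← hc k (by split_ifs at hi hJ <;> omega) (by split_ifs at hi hJ <;> omega)]
      exact Finset.sum_congr rfl fun j _ => mul_comm _ _
  refine key ⟨if μ < B then μ + K else μ - B, ?_⟩ rfl
  split_ifs <;> omega

/-- If an erasure burst starts at position `μ`, the parity checks before index `μ` determine the
non-urgent symbols. -/
theorem IsBEBC.nonurgent_eq_zero (hH : IsBEBC H) {v : Fin (B + K) → V} {μ : ℕ} (hμ : μ < B + K)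
    (hv : ∀ m : Fin (B + K), (m : ℕ) < μ ∨ μ + B ≤ m → v m = 0)
    (hr : ∀ k : Fin B, (k : ℕ) < μ → μ ≤ K + k → ldParity H v k = 0) (j : Fin K) :
    v (Fin.natAdd B j) = 0 := by
  -- The code property concerns scalars, so `V`-valued vectors are tested against linear
  -- functionals.
  rw [← Module.forall_dual_apply_eq_zero_iff F]
  intro φ
  have h : (fun j => φ (v (Fin.natAdd B j))) = 0 := by
    refine hH.eq_zero hμ (fun j hj => ?_) fun k hk hk' => ?_
    · rw [hv _ (by simp only [Fin.val_natAdd]; omega), map_zero]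
    · have h1 := hr k hk hk'
      rw [ldParity, hv _ (by simp only [Fin.val_castAdd]; omega), zero_add] at h1
      simpa using congrArg φ h1
  exact congrFun h j

/-- If an erasure burst starts at position `μ`, the parity checks up to index `μ` determine the
symbol `μ`. -/
theorem IsBEBC.first_eq_zero (hH : IsBEBC H) {v : Fin (B + K) → V} (μ : Fin (B + K))
    (hv : ∀ m : Fin (B + K), m < μ ∨ (μ : ℕ) + B ≤ m → v m = 0)
    (hr : ∀ k : Fin B, (k : ℕ) ≤ μ → (μ : ℕ) ≤ K + k → ldParity H v k = 0) : v μ = 0 := by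
  have hn := hH.nonurgent_eq_zero μ.isLt hv fun k hk => hr k hk.le
  induction μ using Fin.addCases with
  | left k =>
    -- An urgent symbol needs the check with its own index; this is why `k ≤ μ` is assumed here
    -- instead of `k < μ`.
    have := hr k (by simp) (by simp)
    simpa [ldParity, hn] using this
  | right j => exact hn j

end BlockCode

/-! ### Decoding for user 1 along the main diagonals -/

section Streams

variable {F V : Type*} [Field F] [AddCommGroup V] [Module F V] {B K : ℕ}
  {H : Matrix (Fin K) (Fin B) F}

theorem mainParity_eq_zero {b : ℕ} {s : ℤ → Fin (B + K) → V} {k : Fin B} {i : ℤ}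
    (h : ∀ m : Fin (B + K), (k : ℕ) ≤ m →
      s (i - b * (B + K) - (k : ℕ) * b + (m : ℕ) * b) m = 0) :
    mainParity H b s k i = 0 :=
  ldParity_eq_zero H (h _ (by simp)) fun j => h _ (by simp only [Fin.val_natAdd]; omega)

/-- On the main diagonal through sub-symbol μ at time 0, check k arrives at time b(B + K + k - μ),
inside the window exactly when μ - K ≤ k ≤ μ. These are the checks that `IsBEBC.first_eq_zero`
consumes. -/
theorem mainParity_user_one {l b : ℕ} (hb : 0 < b) (hH : IsBEBC H) {s : ℤ → Fin (B + K) → V}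
    (hneg : ∀ z < 0, s z = 0)
    (hs : ∀ z : ℤ, b * B ≤ z → z ≤ b * (B + K) → s z = 0)
    (hq : ∀ (i : ℤ) (k : Fin B), b * B ≤ i → i ≤ b * (B + K) →
      mainParity H b s k i + offParity H l s k (i - b * ((B + K) + B)) = 0) : s 0 = 0 := by
  funext μ
  have hb' : (0 : ℤ) ≤ b := by positivity
  have hb1 : (0 : ℤ) < b := by exact_mod_cast hb
  have hl' : (0 : ℤ) ≤ l := by positivity
  have := hH.first_eq_zero (v := fun m => s (((m : ℕ) - (μ : ℕ) : ℤ) * b) m) μ ?_ ?_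
  · simpa using this
  · rintro m (hm | hm)
    · have hm' : ((m : ℕ) : ℤ) < (μ : ℕ) := by exact_mod_cast hm
      rw [hneg _ (by nlinarith)]; rfl
    · have hm' : ((μ : ℕ) : ℤ) + B ≤ (m : ℕ) := by exact_mod_cast hm
      have hm2 : ((m : ℕ) : ℤ) ≤ B + K := by exact_mod_cast m.isLt.le
      rw [hs _ (by nlinarith) (by nlinarith)]; rfl
  · intro k hk hk'
    have h1 : ((k : ℕ) : ℤ) ≤ (μ : ℕ) := by exact_mod_cast hk
    have h2 : ((μ : ℕ) : ℤ) ≤ K + (k : ℕ) := by exact_mod_cast hk'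
    have h3 := hq (b * (B + K) + ((k : ℕ) - (μ : ℕ)) * b) k (by nlinarith) (by nlinarith)
    have h4 : offParity H l s k (b * (B + K) + ((k : ℕ) - (μ : ℕ)) * b - b * ((B + K) + B)) = 0 := by
      have : ∀ m : Fin (B + K), s (b * (B + K) + ((k : ℕ) - (μ : ℕ)) * b - b * ((B + K) + B)
          - l - (k : ℕ) * l - l * (m.rev : ℕ)) = 0 := fun m => by
        have hBk : ((k : ℕ) : ℤ) < B := by exact_mod_cast k.isLt
        apply hneg
        have := mul_nonneg hl' (Nat.cast_nonneg (α := ℤ) (m.rev : ℕ))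
        have := mul_nonneg hl' (Nat.cast_nonneg (α := ℤ) (k : ℕ))
        nlinarith
      exact ldParity_eq_zero H (by rw [this]; rfl) fun j => by rw [this]; rfl
    rw [h4, add_zero, mainParity] at h3
    convert h3 using 4
    ring

end Streams

/-! ### Decoding for user 2: interplay of the two families of diagonals -/

section UserTwo

variable {F V : Type*} [Field F] [AddCommGroup V] [Module F V] {B K : ℕ}
  {H : Matrix (Fin K) (Fin B) F}

theorem Fin.cast_val_rev {B K : ℕ} (m : Fin (B + K)) :
    ((m.rev : ℕ) : ℤ) = B + K - 1 - (m : ℕ) := by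
  have := m.isLt
  rw [Fin.val_rev]
  omega

/-- The off-diagonal parity check at the time `z + (B + K + k - μ) l`, on the diagonal which passes
through sub-symbol `μ.rev` at time `z`. -/
theorem offParity_diagonal (l : ℕ) (s : ℤ → Fin (B + K) → V) (k : Fin B) (μ z : ℤ) :
    offParity H l s k (z + (B + K + (k : ℕ) - μ) * l) =
      ldParity H (fun m => s (z + ((m : ℕ) - μ) * l) m.rev) k := by
  rw [offParity]
  congr 2
  funext m
  rw [Fin.cast_val_rev]
  ring_nf

theorem mainParity_diagonal (b : ℕ) (s : ℤ → Fin (B + K) → V) (k : Fin B) (μ z : ℤ) :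
    mainParity H b s k (z + (B + K + (k : ℕ) - μ) * b) =
      ldParity H (fun m => s (z + ((m : ℕ) - μ) * b) m) k := by
  rw [mainParity]
  congr 2
  funext m
  ring_nf

/-- The parity checks of the second user, as seen after a burst of length `(b + l) B` starting at
time `0`: the source symbols vanish outside the burst and so do the received parity checks. -/
structure BurstKernel (H : Matrix (Fin K) (Fin B) F) (b l : ℕ) (s : ℤ → Fin (B + K) → V) :
    Prop where
  neg : ∀ z < 0, s z = 0
  late : ∀ z : ℤ, (b + l) * B ≤ z → z ≤ (b + l) * (B + K) + b * B → s z = 0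
  parity : ∀ (i : ℤ) (k : Fin B), (b + l) * B ≤ i → i ≤ (b + l) * (B + K) + b * B →
    mainParity H b s k i + offParity H l s k (i - b * ((B + K) + B)) = 0

namespace BurstKernel

variable {b l : ℕ} {s : ℤ → Fin (B + K) → V}

/-- Check k of the block code ignores entries before k, so the interfering main check at time i +
b(2B + K) reads nothing before i + bB, which is already past the burst. -/
theorem offParity_eq_zero (h : BurstKernel H b l s) (hb : 0 < b) {i : ℤ} (hi : l * B ≤ i)
    (hi' : i ≤ l * (B + K)) (k : Fin B) : offParity H l s k i = 0 := by
  have hb1 : (0 : ℤ) < b := by exact_mod_cast hb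
  have hl : (0 : ℤ) ≤ l := by positivity
  have hB : (0 : ℤ) ≤ B := by positivity
  have hK : (0 : ℤ) ≤ K := by positivity
  have hbB : (0 : ℤ) ≤ b * B := by positivity
  have hbK : (0 : ℤ) ≤ b * K := by positivity
  have hq := h.parity (i + b * ((B + K) + B)) k (by nlinarith) (by nlinarith)
  rw [add_sub_cancel_right] at hq
  rw [← hq, mainParity_eq_zero, zero_add]
  intro m hm
  have h1 : (b : ℤ) * (k : ℕ) ≤ b * (m : ℕ) :=
    mul_le_mul_of_nonneg_left (by exact_mod_cast hm) hb1.le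
  have h2 : (b : ℤ) * (m : ℕ) ≤ b * (B + K) :=
    mul_le_mul_of_nonneg_left (by exact_mod_cast m.isLt.le) hb1.le
  have h3 : (0 : ℤ) ≤ b * (k : ℕ) := by positivity
  rw [h.late _ (by nlinarith) (by nlinarith)]
  rfl

/-- The induction step for the part of the burst which is in reach of the main diagonals. -/
theorem eq_zero_of_late (h : BurstKernel H b l s) (hb : 0 < b) (hl : 0 < l) (hH : IsBEBC H)
    {D : ℤ}
    (ih : ∀ (m : Fin (B + K)) (z : ℤ), (m : ℕ) < K → z + (m : ℕ) * l < D →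
      z ≤ (b + l) * (B + K) + b * B → s z m = 0)
    {m : Fin (B + K)} {z : ℤ} (hm : (m : ℕ) < K) (hD : z + (m : ℕ) * l = D)
    (hz : l * B ≤ z) (hz' : z ≤ (b + l) * (B + K) + b * B) : s z m = 0 := by
  have hb1 : (0 : ℤ) < b := by exact_mod_cast hb
  have hl1 : (0 : ℤ) < l := by exact_mod_cast hl
  have hlB : (0 : ℤ) ≤ l * B := by positivity
  have hlK : (0 : ℤ) ≤ l * K := by positivity
  have hbB : (0 : ℤ) ≤ b * B := by positivity
  have hbK : (0 : ℤ) ≤ b * K := by positivity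
  have hml : (0 : ℤ) ≤ (m : ℕ) * l := by positivity
  rcases le_or_gt (((b + l) * B : ℤ)) z with hz1 | hz1
  · rw [h.late z hz1 hz']; rfl
  have hH' := hH.first_eq_zero (v := fun m' => s (z + ((m' : ℕ) - (m : ℕ)) * b) m') m ?_ ?_
  · simpa using hH'
  · rintro m' (hm' | hm')
    -- One step back on a main diagonal lowers z + ml by b + l, so the induction hypothesis applies.
    · have h1 : ((m' : ℕ) : ℤ) + 1 ≤ (m : ℕ) := by exact_mod_cast hm'
      have h2 := mul_le_mul_of_nonneg_left h1 hb1.le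
      have h3 := mul_le_mul_of_nonneg_left h1 hl1.le
      exact ih m' _ (lt_trans hm' hm) (by nlinarith) (by nlinarith)
    · have h1 : ((m : ℕ) : ℤ) + B ≤ (m' : ℕ) := by exact_mod_cast hm'
      have h2 : ((m' : ℕ) : ℤ) ≤ B + K := by exact_mod_cast m'.isLt.le
      have h3 := mul_le_mul_of_nonneg_left h1 hb1.le
      have h4 := mul_le_mul_of_nonneg_left h2 hb1.le
      have h5 : (0 : ℤ) ≤ b * (m : ℕ) := by positivity
      rw [h.late _ (by nlinarith) (by nlinarith)]; rfl
  · intro k hk hk'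
    have h1 : (b : ℤ) * (k : ℕ) ≤ b * (m : ℕ) :=
      mul_le_mul_of_nonneg_left (by exact_mod_cast hk) hb1.le
    have h2 : (b : ℤ) * (m : ℕ) ≤ b * (K + (k : ℕ)) :=
      mul_le_mul_of_nonneg_left (by exact_mod_cast hk') hb1.le
    have h3 : (0 : ℤ) ≤ l * (k : ℕ) := by positivity
    have hq := h.parity (z + (B + K + (k : ℕ) - (m : ℕ)) * b) k (by nlinarith) (by nlinarith)
    rw [mainParity_diagonal] at hq
    rw [← hq, left_eq_add]
    -- The interfering opposite check is already known: its urgent entry has negative time because z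
    -- < (b + l)B, and its other entries lie on smaller opposite diagonals.
    refine ldParity_eq_zero H ?_ fun j => ?_
    · rw [h.neg _ ?_]
      · rfl
      · rw [Fin.cast_val_rev, Fin.val_castAdd]
        nlinarith
    · have hj : ((Fin.natAdd B j).rev : ℕ) < K := by
        rw [Fin.val_rev, Fin.val_natAdd]; omega
      refine ih _ _ hj ?_ ?_
      · nlinarith
      · have : (0 : ℤ) ≤ l * ((Fin.natAdd B j).rev : ℕ) := by positivity
        nlinarith

/-- The induction step for the part of the burst which is in reach of the opposite diagonals. -/
theorem eq_zero_of_early (h : BurstKernel H b l s) (hb : 0 < b) (hl : 0 < l) (hH : IsBEBC H)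
    {D : ℤ}
    (ih : ∀ (m : Fin (B + K)) (z : ℤ), (m : ℕ) < K → z + (m : ℕ) * l = D →
      l * B ≤ z → z ≤ (b + l) * (B + K) + b * B → s z m = 0)
    {m : Fin (B + K)} {z : ℤ} (hm : (m : ℕ) < K) (hD : z + (m : ℕ) * l = D)
    (hz : z < l * B) : s z m = 0 := by
  have hb1 : (0 : ℤ) < b := by exact_mod_cast hb
  have hl1 : (0 : ℤ) < l := by exact_mod_cast hl
  have hlB : (0 : ℤ) ≤ l * B := by positivity
  have hlK : (0 : ℤ) ≤ l * K := by positivity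
  have hbB : (0 : ℤ) ≤ b * B := by positivity
  have hbK : (0 : ℤ) ≤ b * K := by positivity
  rcases lt_or_ge z 0 with hz0 | hz0
  · rw [h.neg z hz0]; rfl
  -- The diagonal has step l, so c steps back from time z lead to its first entry at nonnegative
  -- time, namely r. The position μ of that entry is where the erasure burst starts.
  obtain ⟨c, r, hr, hzc⟩ : ∃ c r : ℕ, r < l ∧ z = c * l + r := by
    refine ⟨z.toNat / l, z.toNat % l, Nat.mod_lt _ hl, ?_⟩
    have := Nat.div_add_mod' z.toNat l
    rw [← Int.toNat_of_nonneg hz0]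
    exact_mod_cast this.symm
  have hr' : (r : ℤ) + 1 ≤ l := by exact_mod_cast hr
  have hr0 : (0 : ℤ) ≤ r := by positivity
  have hcB : c < B := by
    have : (l : ℤ) * c < l * B := by nlinarith
    exact_mod_cast lt_of_mul_lt_mul_left this hl1.le
  have hmK := m.isLt
  obtain ⟨μ, hμ⟩ : ∃ μ : ℕ, μ + c = (m.rev : ℕ) := ⟨m.rev - c, by rw [Fin.val_rev]; omega⟩
  have hμ2 : (μ : ℤ) + c = B + K - 1 - (m : ℕ) := by rw [← Fin.cast_val_rev]; exact_mod_cast hμ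
  have hmrev : B ≤ (m.rev : ℕ) := by rw [Fin.val_rev]; omega
  have hBμ : (B : ℤ) ≤ μ + c := by exact_mod_cast hμ ▸ hmrev
  have key := hH.nonurgent_eq_zero
    (v := fun m' => s (z + ((m' : ℕ) - (μ + c : ℤ)) * l) m'.rev) (μ := μ)
    (by have := m.rev.isLt; omega) ?_ ?_ ⟨m.rev - B, by have := m.rev.isLt; omega⟩
  · rw [show Fin.natAdd B ⟨(m.rev : ℕ) - B, _⟩ = m.rev from
      Fin.ext (by simp only [Fin.val_natAdd]; omega)] at key
    have hμ3 : ((m.rev : ℕ) : ℤ) = μ + c := by exact_mod_cast hμ.symm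
    simpa only [hμ3, sub_self, zero_mul, add_zero, Fin.rev_rev] using key
  · rintro m' (hm' | hm')
    · have h1 : ((m' : ℕ) : ℤ) + 1 ≤ μ := by exact_mod_cast hm'
      have h2 := mul_le_mul_of_nonneg_left h1 hl1.le
      rw [h.neg _ (by nlinarith)]; rfl
    · have h1 : (μ : ℤ) + B ≤ (m' : ℕ) := by exact_mod_cast hm'
      have h2 : ((m' : ℕ) : ℤ) ≤ B + K := by exact_mod_cast m'.isLt.le
      have h3 := mul_le_mul_of_nonneg_left h1 hl1.le
      have h4 := mul_le_mul_of_nonneg_left h2 hl1.le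
      have h5 := mul_le_mul_of_nonneg_left hBμ hl1.le
      refine ih _ _ (by rw [Fin.val_rev]; omega) ?_ (by nlinarith) (by nlinarith)
      rw [Fin.cast_val_rev, ← hD, hμ2]
      ring
  -- Check k comes at time r + (B + K + k - μ)l. For k = μ it would overshoot l(B + K) when r > 0,
  -- so only k < μ is used, which suffices for non-urgent symbols.
  · intro k hk hk'
    have h1 : ((k : ℕ) : ℤ) + 1 ≤ μ := by exact_mod_cast hk
    have h2 : (μ : ℤ) ≤ K + (k : ℕ) := by exact_mod_cast hk'
    have h3 := mul_le_mul_of_nonneg_left h1 hl1.le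
    have h4 := mul_le_mul_of_nonneg_left h2 hl1.le
    rw [← offParity_diagonal]
    exact h.offParity_eq_zero hb (by nlinarith) (by nlinarith) k

/-- All sub-symbols which are non-urgent on the opposite diagonals vanish. -/
theorem nonurgent_eq_zero (h : BurstKernel H b l s) (hb : 0 < b) (hl : 0 < l) (hH : IsBEBC H)
    {m : Fin (B + K)} {z : ℤ} (hm : (m : ℕ) < K)
    (hz : z ≤ (b + l) * (B + K) + b * B) : s z m = 0 := by
  -- z + ml is constant on each opposite diagonal; where it is negative, z is negative too, which
  -- starts the induction.
  suffices hD : ∀ (D : ℕ) (m : Fin (B + K)) (z : ℤ), (m : ℕ) < K → z + (m : ℕ) * l < D →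
      z ≤ (b + l) * (B + K) + b * B → s z m = 0 by
    refine hD (z + (m : ℕ) * l + 1).toNat m z hm ?_ hz
    have := Int.self_le_toNat (z + (m : ℕ) * l + 1)
    omega
  intro D
  induction D with
  | zero =>
    intro m z _ hz _
    have : (0 : ℤ) ≤ (m : ℕ) * l := by positivity
    rw [h.neg z (by push_cast at hz; linarith)]; rfl
  | succ D ih =>
    have hlate : ∀ (m : Fin (B + K)) (z : ℤ), (m : ℕ) < K → z + (m : ℕ) * l = D →
        l * B ≤ z → z ≤ (b + l) * (B + K) + b * B → s z m = 0 :=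
      fun m z hm hD hz hz' => h.eq_zero_of_late hb hl hH ih hm hD hz hz'
    intro m z hm hzD hz
    push_cast at hzD
    rcases lt_or_eq_of_le (Int.lt_add_one_iff.1 hzD) with hlt | heq
    · exact ih m z hm hlt hz
    · rcases le_or_gt ((l : ℤ) * B) z with hz1 | hz1
      · exact hlate m z hm heq hz1 hz
      · exact h.eq_zero_of_early hb hl hH hlate hm heq hz1

/-- At time 0 there is no remainder r, so the check k = μ falls exactly on the last usable time l(B
+ K), and urgent symbols are recovered as well. -/
theorem eq_zero (h : BurstKernel H b l s) (hb : 0 < b) (hl : 0 < l) (hH : IsBEBC H) :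
    s 0 = 0 := by
  funext m
  have hb1 : (0 : ℤ) < b := by exact_mod_cast hb
  have hl1 : (0 : ℤ) < l := by exact_mod_cast hl
  have hbB : (0 : ℤ) ≤ b * B := by positivity
  have hbK : (0 : ℤ) ≤ b * K := by positivity
  have key := hH.first_eq_zero
    (v := fun m' => s (0 + ((m' : ℕ) - ((m.rev : ℕ) : ℤ)) * l) m'.rev) m.rev ?_ ?_
  · simpa using key
  · have h0 : (0 : ℤ) ≤ l * (m.rev : ℕ) := by positivity
    rintro m' (hm' | hm')
    · have h1 : ((m' : ℕ) : ℤ) + 1 ≤ (m.rev : ℕ) := by exact_mod_cast hm'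
      have h2 := mul_le_mul_of_nonneg_left h1 hl1.le
      rw [h.neg _ (by nlinarith)]; rfl
    · have h2 : ((m' : ℕ) : ℤ) ≤ B + K := by exact_mod_cast m'.isLt.le
      have h4 := mul_le_mul_of_nonneg_left h2 hl1.le
      exact h.nonurgent_eq_zero hb hl hH (by rw [Fin.val_rev]; omega) (by nlinarith)
  · intro k hk hk'
    have h1 : ((k : ℕ) : ℤ) ≤ (m.rev : ℕ) := by exact_mod_cast hk
    have h2 : ((m.rev : ℕ) : ℤ) ≤ K + (k : ℕ) := by exact_mod_cast hk'
    have h3 := mul_le_mul_of_nonneg_left h1 hl1.le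
    have h4 := mul_le_mul_of_nonneg_left h2 hl1.le
    rw [← offParity_diagonal]
    exact h.offParity_eq_zero hb (by nlinarith) (by nlinarith) k

end BurstKernel

end UserTwo

/-! ### Decoding additive codes, and pseudo-expansion -/

namespace StreamingCode

/-- The encoding maps are additive. -/
def Additive {S X : Type*} [Add S] [Add X] (c : StreamingCode S X) : Prop :=
  ∀ (t : ℕ) (s s' : Fin (t + 1) → S), c t (s + s') = c t s + c t s'

/-- An additive systematic code decodes sequentially: it suffices to recover the first symbol of
a burst. -/
theorem Additive.achievesDelay {S X : Type*} [AddGroup S] [AddGroup X] {c : StreamingCode S X}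
    (hc : c.Additive) (hsys : ∀ s t, c.output s t = 0 → s t = 0) {B T : ℕ}
    (h : ∀ (s : ℕ → S) (t : ℕ), (∀ i < t, s i = 0) →
      (∀ i, t + B ≤ i → i ≤ t + T → c.output s i = 0) → s t = 0) :
    c.AchievesDelay B T := by
  have hker : ∀ (j : ℕ) (s : ℕ → S) (t : ℕ),
      (∀ i ≤ t + T, ¬ (j ≤ i ∧ i < j + B) → c.output s i = 0) → s t = 0 := by
    intro j s t
    induction t using Nat.strong_induction_on with
    | _ t ih =>
      intro hs
      by_cases ht : j ≤ t ∧ t < j + B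
      · exact h s t (fun i hi => ih i hi fun i' hi' => hs i' (by omega))
          fun i hi hi' => hs i hi' (by omega)
      · exact hsys s t (hs t (by omega) ht)
  have hsub : ∀ s s' : ℕ → S, ∀ t, c.output s t = c.output s' t → c.output (s - s') t = 0 := by
    intro s s' t heq
    have h1 := hc t (fun i => (s - s') i) (fun i => s' i)
    have h2 : ((fun i : Fin (t + 1) => (s - s') i) + fun i : Fin (t + 1) => s' i) =
        fun i : Fin (t + 1) => s i := by
      funext i
      simp
    rw [h2] at h1
    change c.output s t = c.output (s - s') t + c.output s' t at h1
    rw [heq] at h1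
    exact right_eq_add.1 h1
  -- The decoder is not told the burst position; equal receptions already force equal erasure
  -- patterns within the window.
  have hdet : ∀ (j j' : ℕ) (s s' : ℕ → S) (t : ℕ),
      (∀ i ≤ t + T, c.received B j s i = c.received B j' s' i) → s t = s' t := by
    intro j j' s s' t hr
    rw [← sub_eq_zero]
    refine hker j (s - s') t fun i hi hij => hsub s s' i ?_
    have := hr i hi
    unfold received at this
    rw [if_neg hij] at this
    split_ifs at this
    exact Option.some.inj this
  classical
  -- Decode to any stream consistent with the reception; the value 0 is only for receptions that
  -- never occur.
  refine ⟨fun t y => if hy : ∃ p : ℕ × (ℕ → S), y = fun i : Fin (t + T + 1) => c.received B p.1 p.2 i then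
    hy.choose.2 t else 0, fun j s t => ?_⟩
  have hy : ∃ p : ℕ × (ℕ → S), (fun i : Fin (t + T + 1) => c.received B j s i) =
      fun i : Fin (t + T + 1) => c.received B p.1 p.2 i := ⟨(j, s), rfl⟩
  dsimp only
  rw [dif_pos hy]
  exact (hdet j hy.choose.1 s hy.choose.2 t
    fun i hi => congrFun hy.choose_spec ⟨i, by omega⟩).symm

theorem output_congr_time {S X : Type*} (c : StreamingCode S X) (s : ℕ → S) {t t' : ℕ}
    (h : t = t') : c t (fun i => s i) = c.output s t' := by
  subst h; rfl

/-- A burst of B blocks is one of nB fine symbols. The fine deadline nt + r + T' is at most n(t + T)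
+ r, still inside block t + T, so the offset r costs nothing. -/
theorem AchievesDelay.pseudoExpand {S X : Type*} {c : StreamingCode S X} {n B T B' T' : ℕ}
    (h : c.AchievesDelay B' T') (hB : n * B = B') (hT : T' ≤ n * T) :
    (pseudoExpand n c).AchievesDelay B T := by
  obtain ⟨γ, hγ⟩ := h
  have hlt : ∀ t (r : Fin n) (i : Fin (n * t + r + T' + 1)), (i : ℕ) / n < t + T + 1 :=
    fun t r i => Nat.div_lt_of_lt_mul (by
      have h1 := i.isLt
      have h2 := r.isLt
      rw [Nat.mul_add, Nat.mul_add, Nat.mul_one]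
      omega)
  refine ⟨fun t y r => γ (n * t + r) fun i =>
    (y ⟨(i : ℕ) / n, hlt t r i⟩).map fun x => x ⟨(i : ℕ) % n, Nat.mod_lt _ r.pos⟩,
    fun j s t => ?_⟩
  funext r
  have hn := r.pos
  have key := hγ (n * j) (fun i => s (i / n) ⟨i % n, Nat.mod_lt _ hn⟩) (n * t + r)
  have hdiv : (n * t + r) / n = t := by
    rw [Nat.mul_add_div hn, Nat.div_eq_of_lt r.isLt, add_zero]
  have hmod : (⟨(n * t + r) % n, Nat.mod_lt _ hn⟩ : Fin n) = r :=
    Fin.ext (by simp [Nat.mod_eq_of_lt r.isLt])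
  rw [hdiv, hmod] at key
  rw [← key]
  refine congrArg (γ (n * t + r)) (funext fun i => ?_)
  have hij : n * j ≤ i ∧ (i : ℕ) < n * j + B' ↔ j ≤ (i : ℕ) / n ∧ (i : ℕ) / n < j + B := by
    rw [Nat.le_div_iff_mul_le hn, Nat.div_lt_iff_lt_mul hn, ← hB, mul_comm j, add_mul,
      mul_comm j, mul_comm B]
  unfold received
  dsimp only
  by_cases hi : j ≤ (i : ℕ) / n ∧ (i : ℕ) / n < j + B
  · rw [if_pos (hij.2 hi), if_pos hi]
    rfl
  · rw [if_neg (mt hij.1 hi), if_neg hi]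
    simp only [Option.map_some, output, _root_.pseudoExpand]
    exact congrArg some (c.output_congr_time (fun i => s (i / n) ⟨i % n, Nat.mod_lt _ hn⟩)
      (Nat.div_add_mod (i : ℕ) n))

end StreamingCode

/-! ### Entropy and rate -/

theorem shannonEntropy_le_log_card {X : Type*} [Fintype X] [Nonempty X] (p : PMF X) :
    shannonEntropy p ≤ Real.log (Fintype.card X) := by
  have hsum : ∑ x, (p x).toReal = 1 := by
    rw [← ENNReal.toReal_sum fun x _ => p.apply_ne_top x, ← tsum_fintype (L := .unconditional _), p.tsum_coe,
      ENNReal.toReal_one]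
  have hcard : (0 : ℝ) < Fintype.card X := by exact_mod_cast Fintype.card_pos
  -- Jensen's inequality with equal weights.
  have h := Real.concaveOn_negMulLog.le_map_sum (t := Finset.univ)
    (w := fun _ : X => (Fintype.card X : ℝ)⁻¹) (p := fun x => (p x).toReal)
    (fun _ _ => by positivity) (by simp [hcard.ne']) fun x _ => ENNReal.toReal_nonneg
  simp only [smul_eq_mul, ← Finset.mul_sum, hsum, mul_one] at h
  rw [Real.negMulLog, Real.log_inv, neg_mul_neg, inv_mul_le_iff₀ hcard,
    mul_inv_cancel_left₀ hcard.ne'] at h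
  exact h

theorem shannonEntropy_uniformOfFintype (X : Type*) [Fintype X] [Nonempty X] :
    shannonEntropy (PMF.uniformOfFintype X) = Real.log (Fintype.card X) := by
  have hcard : (Fintype.card X : ℝ) ≠ 0 := by exact_mod_cast Fintype.card_ne_zero
  simp [shannonEntropy, Real.negMulLog, Finset.sum_const, hcard]

/-- The fibres are cosets of the kernel, so translation makes all point masses equal. -/
theorem map_uniformOfFintype_of_surjective {A X : Type*} [AddGroup A] [AddGroup X] [Fintype A]
    [Fintype X] (f : A →+ X) (hf : Function.Surjective f) :
    (PMF.uniformOfFintype A).map f = PMF.uniformOfFintype X := by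
  classical
  have hconst : ∀ y, (PMF.uniformOfFintype A).map f y = (PMF.uniformOfFintype A).map f 0 := by
    intro y
    obtain ⟨a₀, rfl⟩ := hf y
    rw [PMF.map_apply, PMF.map_apply, ← (Equiv.addRight a₀).tsum_eq]
    refine tsum_congr fun a => ?_
    simp [eq_comm (a := (0 : X))]
  ext y
  have hsum := ((PMF.uniformOfFintype A).map f).tsum_coe
  rw [tsum_fintype, Finset.sum_congr rfl fun x _ => hconst x, Finset.sum_const, nsmul_eq_mul,
    Finset.card_univ, mul_comm] at hsum
  rw [hconst, PMF.uniformOfFintype_apply]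
  exact ENNReal.eq_inv_of_mul_eq_one_left hsum

namespace StreamingCode

theorem Additive.hasRate {S X : Type*} [AddGroup S] [AddGroup X] [Fintype S] [Nonempty S]
    [Fintype X] {c : StreamingCode S X} (hc : c.Additive)
    (hsurj : ∀ᶠ t in Filter.atTop, Function.Surjective (c t)) {R : ℝ} (hR : 0 ≤ R)
    (hX : Real.log (Fintype.card X) ≠ 0)
    (hcard : Real.log (Fintype.card S) = R * Real.log (Fintype.card X)) : c.HasRate R := by
  have hS : sourceEntropy S = R * Real.log (Fintype.card X) := by
    rw [sourceEntropy, shannonEntropy_uniformOfFintype, hcard]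
  constructor
  · filter_upwards [hsurj] with t ht
    have h := map_uniformOfFintype_of_surjective (AddMonoidHom.mk' (c t) (hc t)) ht
    change (PMF.uniformOfFintype (Fin (t + 1) → S)).map (c t) = _ at h
    rw [hS, channelEntropy, h, shannonEntropy_uniformOfFintype, mul_div_assoc, div_self hX,
      mul_one]
  · intro t
    rw [hS]
    exact mul_le_mul_of_nonneg_left (shannonEntropy_le_log_card _) hR

end StreamingCode

/-! ### Linearity, delays and rate of the construction -/

/-- The extension of a stream by zero to negative times. -/
def zeroExtend {A : Type*} [Zero A] (s : ℕ → A) (z : ℤ) : A :=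
  if 0 ≤ z then s z.toNat else 0

theorem zeroExtend_natCast {A : Type*} [Zero A] (s : ℕ → A) (t : ℕ) : zeroExtend s t = s t := by
  simp [zeroExtend]

theorem symbolAt_restrict {A : Type*} [Zero A] (s : ℕ → A) {t : ℕ} {z : ℤ} (h : z ≤ t) :
    symbolAt (fun i : Fin (t + 1) => s i) z = zeroExtend s z := by
  unfold symbolAt zeroExtend
  split_ifs <;> first | rfl | omega

theorem symbolAt_add {A : Type*} [AddZeroClass A] {t : ℕ} (s s' : Fin (t + 1) → A) (z : ℤ) :
    symbolAt (s + s') z = symbolAt s z + symbolAt s' z := by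
  unfold symbolAt
  split_ifs <;> simp

section Desco

variable {F V : Type*} [Field F] [AddCommGroup V] [Module F V] {B K : ℕ}
  {H : Matrix (Fin K) (Fin B) F}

theorem mainParity_congr {b : ℕ} {s s' : ℤ → Fin (B + K) → V} {i : ℤ}
    (h : ∀ z ≤ i, s z = s' z) (k : Fin B) : mainParity H b s k i = mainParity H b s' k i := by
  unfold mainParity
  congr 1
  funext m
  have h1 : (b : ℤ) * (m : ℕ) ≤ b * (B + K) :=
    mul_le_mul_of_nonneg_left (by exact_mod_cast m.isLt.le) (by positivity)
  have h2 : (0 : ℤ) ≤ (k : ℕ) * b := by positivity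
  rw [h _ (by linarith)]

theorem offParity_congr {l : ℕ} {s s' : ℤ → Fin (B + K) → V} {i : ℤ}
    (h : ∀ z ≤ i, s z = s' z) (k : Fin B) : offParity H l s k i = offParity H l s' k i := by
  unfold offParity
  congr 1
  funext m
  have h1 : (0 : ℤ) ≤ l * (m.rev : ℕ) := by positivity
  have h2 : (0 : ℤ) ≤ (k : ℕ) * l := by positivity
  rw [h _ (by linarith [Int.natCast_nonneg l])]

theorem mainParity_shift (H : Matrix (Fin K) (Fin B) F) (b : ℕ) (s : ℤ → Fin (B + K) → V)
    (k : Fin B) (i t : ℤ) :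
    mainParity H b (fun z => s (z + t)) k i = mainParity H b s k (i + t) := by
  unfold mainParity
  congr 1
  funext m
  ring_nf

theorem offParity_shift (H : Matrix (Fin K) (Fin B) F) (l : ℕ) (s : ℤ → Fin (B + K) → V)
    (k : Fin B) (i t : ℤ) :
    offParity H l (fun z => s (z + t)) k i = offParity H l s k (i + t) := by
  unfold offParity
  congr 1
  funext m
  ring_nf

theorem desco_output (H : Matrix (Fin K) (Fin B) F) (a b : ℕ) (s : ℕ → Fin (B + K) → V) (t : ℕ) :
    (desco H a b).output s t = (s t, fun k => mainParity H b (zeroExtend s) k t +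
      offParity H (a - b) (zeroExtend s) k (t - b * ((B + K) + B))) := by
  have h : (0 : ℤ) ≤ b * ((B + K) + B) := by positivity
  refine Prod.ext rfl (funext fun k => ?_)
  exact congrArg₂ (· + ·) (mainParity_congr (fun z hz => symbolAt_restrict s hz) k)
    (offParity_congr (fun z hz => symbolAt_restrict s (by linarith)) k)

theorem desco_additive (H : Matrix (Fin K) (Fin B) F) (a b : ℕ) :
    (desco (V := V) H a b).Additive := by
  intro t s s'
  refine Prod.ext rfl (funext fun k => ?_)
  simp only [desco, mainParity, offParity, symbolAt_add, Pi.add_apply, ldParity_add,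
    Prod.snd_add]
  abel

/-- The data seen by a user after a burst starting at time `t`, shifted to the origin. -/
theorem desco_kernel {a b : ℕ} {s : ℕ → Fin (B + K) → V} {t B' T' : ℕ}
    (hs : ∀ i < t, s i = 0)
    (h : ∀ i, t + B' ≤ i → i ≤ t + T' → (desco H a b).output s i = 0) :
    (∀ z < 0, zeroExtend s (z + t) = 0) ∧
      (∀ z : ℤ, B' ≤ z → z ≤ T' → zeroExtend s (z + t) = 0) ∧
      ∀ (i : ℤ) (k : Fin B), B' ≤ i → i ≤ T' →
        mainParity H b (fun z => zeroExtend s (z + t)) k i +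
          offParity H (a - b) (fun z => zeroExtend s (z + t)) k (i - b * ((B + K) + B)) = 0 := by
  refine ⟨fun z hz => ?_, fun z hz hz' => ?_, fun i k hi hi' => ?_⟩
  · unfold zeroExtend
    split_ifs with h0
    · exact hs _ (by omega)
    · rfl
  · lift z to ℕ using by omega
    have := h (z + t) (by omega) (by omega)
    rw [desco_output] at this
    rw [← Nat.cast_add, zeroExtend_natCast]
    exact congrArg Prod.fst this
  · lift i to ℕ using by omega
    have := h (i + t) (by omega) (by omega)
    rw [desco_output] at this
    rw [mainParity_shift, offParity_shift,
      show (i : ℤ) - b * ((B + K) + B) + t = ((i + t : ℕ) : ℤ) - b * ((B + K) + B) by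
        push_cast; ring, ← Nat.cast_add]
    exact congrFun (congrArg Prod.snd this) k

theorem desco_achievesDelay_user_one {a b : ℕ} (hb : 0 < b) (hH : IsBEBC H) :
    (desco (V := V) H a b).AchievesDelay (b * B) (b * (B + K)) := by
  refine (desco_additive H a b).achievesDelay
    (fun s t h => by rw [desco_output] at h; exact congrArg Prod.fst h) fun s t hs h => ?_
  obtain ⟨h1, h2, h3⟩ := desco_kernel hs h
  push_cast at h2 h3
  have := mainParity_user_one hb hH h1 h2 h3
  rwa [zero_add, zeroExtend_natCast] at this

theorem desco_achievesDelay_user_two {a b : ℕ} (hb : 0 < b) (hab : b < a) (hH : IsBEBC H) :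
    (desco (V := V) H a b).AchievesDelay (a * B) (a * (B + K) + b * B) := by
  refine (desco_additive H a b).achievesDelay
    (fun s t h => by rw [desco_output] at h; exact congrArg Prod.fst h) fun s t hs h => ?_
  obtain ⟨h1, h2, h3⟩ := desco_kernel hs h
  have ha : (a : ℤ) = b + (a - b : ℕ) := by omega
  push_cast [ha] at h2 h3
  have := BurstKernel.eq_zero ⟨h1, h2, h3⟩ hb (by omega) hH
  rwa [zero_add, zeroExtend_natCast] at this

/-- Every window of `n ≤ b B` channel symbols can be prescribed after time `b (B + K)`. -/
theorem desco_exists_output (H : Matrix (Fin K) (Fin B) F) (a : ℕ) {b n M : ℕ}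
    (hn : n ≤ b * B) (hM : b * (B + K) ≤ M)
    (x : ℕ → (Fin (B + K) → V) × (Fin B → V)) :
    ∃ s : ℕ → Fin (B + K) → V, ∀ r < n, (desco H a b).output s (M + r) = x r := by
  -- Symbols from time M on are forced by `x`. The parity at M + r also contains the urgent
  -- sub-symbol k at time M + r - b(B + K), still free, and this is chosen to absorb the rest `g`.
  -- Such corrections touch only urgent coordinates, so `g` can be computed from `base`.
  set base : ℕ → Fin (B + K) → V := fun i => if M ≤ i then (x (i - M)).1 else 0 with hbase
  set g : ℕ → Fin B → V := fun r k => ∑ j : Fin K, H j k •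
    zeroExtend base (((M + r : ℕ) : ℤ) - b * (B + K) - (k : ℕ) * b +
      ((Fin.natAdd B j : Fin (B + K)) : ℕ) * b) (Fin.natAdd B j) with hg
  set s : ℕ → Fin (B + K) → V := fun i => if M ≤ i then (x (i - M)).1 else
    if M - b * (B + K) ≤ i then Fin.append (fun k => (x (i - (M - b * (B + K)))).2 k -
      g (i - (M - b * (B + K))) k) (fun _ : Fin K => (0 : V)) else 0 with hs
  have hM' : ((b * (B + K) : ℕ) : ℤ) ≤ M := by exact_mod_cast hM
  have hn' : (n : ℤ) ≤ b * B := by exact_mod_cast hn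
  push_cast at hM'
  have hK : (0 : ℤ) ≤ b * K := by positivity
  refine ⟨s, fun r hr => ?_⟩
  have hr' : (r : ℤ) + 1 ≤ n := by exact_mod_cast hr
  have hnatAdd : ∀ z (j : Fin K),
      zeroExtend s z (Fin.natAdd B j) = zeroExtend base z (Fin.natAdd B j) := by
    intro z j
    simp only [zeroExtend, hs, hbase]
    split_ifs <;> simp
  rw [desco_output]
  refine Prod.ext (by simp [hs]) (funext fun k => ?_)
  -- As r < bB, the delayed opposite check reads only times before M - b(B + K), where `s` is zero.
  have hoff : offParity H (a - b) (zeroExtend s) k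
      (((M + r : ℕ) : ℤ) - b * ((B + K) + B)) = 0 := by
    rw [offParity_congr (s' := fun _ => 0) (fun z hz => ?_)]
    · exact ldParity_eq_zero H rfl fun _ => rfl
    · push_cast at hz
      unfold zeroExtend
      split_ifs with h0
      · have hz' : ((z.toNat : ℕ) : ℤ) = z := Int.toNat_of_nonneg h0
        have h1 : z.toNat < M - b * (B + K) := by
          zify [hM]
          rw [hz']
          linarith
        simp only [hs]
        rw [if_neg (by omega), if_neg (by omega)]
      · rfl
  have hu : zeroExtend s (((M + r : ℕ) : ℤ) - b * (B + K) - (k : ℕ) * b +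
      ((Fin.castAdd K k : Fin (B + K)) : ℕ) * b) (Fin.castAdd K k) = (x r).2 k - g r k := by
    rw [Fin.val_castAdd, sub_add_cancel, show ((M + r : ℕ) : ℤ) - b * (B + K) =
      ((M - b * (B + K) + r : ℕ) : ℤ) by push_cast [hM]; ring, zeroExtend_natCast]
    have h1 : M - b * (B + K) + r < M := by
      zify [hM]
      linarith
    simp only [hs]
    rw [if_neg (by omega), if_pos (by omega)]
    simp
  change _ + offParity H (a - b) (zeroExtend s) k (((M + r : ℕ) : ℤ) - b * ((B + K) + B)) = _
  rw [hoff, add_zero, mainParity, ldParity, hu]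
  simp only [hnatAdd]
  exact sub_add_cancel _ _

theorem pseudoExpand_additive {S X : Type*} [Add S] [Add X] {c : StreamingCode S X}
    (hc : c.Additive) (n : ℕ) : (pseudoExpand n c).Additive :=
  fun _ _ _ => funext fun _ => hc _ _ _

theorem desco_surjective (H : Matrix (Fin K) (Fin B) F) (a : ℕ) {b t : ℕ} (hbB : 1 ≤ b * B)
    (ht : b * (B + K) ≤ t) : Function.Surjective (desco (V := V) H a b t) := by
  intro x
  obtain ⟨s, hs⟩ := desco_exists_output H a hbB ht fun _ => x
  exact ⟨fun i => s i, hs 0 one_pos⟩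

theorem pseudoExpand_desco_surjective (H : Matrix (Fin K) (Fin B) F) (a : ℕ) {b n t : ℕ}
    (hn : n ≤ b * B) (ht : b * (B + K) ≤ n * t) :
    Function.Surjective (pseudoExpand n (desco (V := V) H a b) t) := by
  intro x
  obtain ⟨s, hs⟩ := desco_exists_output H a hn ht
    fun r => if h : r < n then x ⟨r, h⟩ else 0
  refine ⟨fun i r => s (n * i + r), funext fun r => ?_⟩
  have := hs r r.isLt
  rw [dif_pos r.isLt] at this
  rw [pseudoExpand, ← this]
  simp only [Nat.div_add_mod]
  rfl

variable [Fintype V] [Nontrivial V]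

theorem desco_isDESCo (hB : 0 < B) {a b : ℕ} (hb : 0 < b) (hab : b < a) (hH : IsBEBC H) :
    (desco (V := V) H a b).IsDESCo (b * B) (b * (B + K)) (a * B) (a * (B + K) + b * B) := by
  have hlog : Real.log (Fintype.card V) ≠ 0 :=
    (Real.log_pos (by exact_mod_cast Fintype.one_lt_card)).ne'
  have hb' : (b : ℝ) ≠ 0 := by positivity
  have hB' : (0 : ℝ) < B := by positivity
  refine ⟨Nat.mul_lt_mul_of_pos_right hab hB, ?_, desco_achievesDelay_user_one hb hH,
    desco_achievesDelay_user_two hb hab hH⟩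
  refine (desco_additive H a b).hasRate ?_ (by positivity) ?_ ?_
  · filter_upwards [Filter.eventually_ge_atTop (b * (B + K))] with t ht
    exact desco_surjective H a (Nat.mul_pos hb hB) ht
  · simp only [Fintype.card_prod, Fintype.card_fun, Fintype.card_fin, ← pow_add]
    push_cast
    rw [Real.log_pow]
    push_cast
    exact mul_ne_zero (by positivity) hlog
  · simp only [Fintype.card_prod, Fintype.card_fun, Fintype.card_fin, ← pow_add]
    push_cast
    rw [Real.log_pow, Real.log_pow]
    push_cast
    field_simp

theorem pseudoExpand_desco_isDESCo {a b n B' T B₂ T₂ : ℕ} (hn : 0 < n) (hb : 0 < b) (hab : b < a)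
    (hB' : 0 < B') (hB : n * B' = b * B) (hT : n * T = b * (B + K)) (hB₂ : n * B₂ = a * B)
    (hT₂ : a * (B + K) + b * B ≤ n * T₂) (hH : IsBEBC H) :
    (pseudoExpand n (desco (V := V) H a b)).IsDESCo B' T B₂ T₂ := by
  have hB0 : 0 < B := Nat.pos_of_mul_pos_left (hB ▸ Nat.mul_pos hn hB')
  have hlog : Real.log (Fintype.card V) ≠ 0 :=
    (Real.log_pos (by exact_mod_cast Fintype.one_lt_card)).ne'
  have hn' : (0 : ℝ) < n := by positivity
  have hb' : (0 : ℝ) < b := by positivity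
  have hB0' : (0 : ℝ) < B := by positivity
  have hR : (T : ℝ) / (T + B') = (B + K) / (B + K + B) := by
    have h1 : (n : ℝ) * B' = b * B := by exact_mod_cast hB
    have h2 : (n : ℝ) * T = b * (B + K) := by exact_mod_cast hT
    rw [← mul_div_mul_left _ _ hn'.ne', mul_add, h1, h2, ← mul_add, mul_div_mul_left _ _ hb'.ne']
  refine ⟨lt_of_mul_lt_mul_left (a := n) ?_ (Nat.zero_le _), ?_,
    (desco_achievesDelay_user_one hb hH).pseudoExpand hB hT.ge,
    (desco_achievesDelay_user_two hb hab hH).pseudoExpand hB₂ hT₂⟩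
  · rw [hB, hB₂]
    exact Nat.mul_lt_mul_of_pos_right hab hB0
  refine (pseudoExpand_additive (desco_additive H a b) n).hasRate ?_ (by positivity) ?_ ?_
  · filter_upwards [Filter.eventually_ge_atTop T] with t ht
    exact pseudoExpand_desco_surjective H a (hB ▸ Nat.le_mul_of_pos_right n hB')
      (hT ▸ Nat.mul_le_mul_left n ht)
  · simp only [Fintype.card_prod, Fintype.card_fun, Fintype.card_fin, ← pow_add, ← pow_mul]
    push_cast
    rw [Real.log_pow]
    push_cast
    exact mul_ne_zero (by positivity) hlog
  · simp only [Fintype.card_prod, Fintype.card_fun, Fintype.card_fin, ← pow_add, ← pow_mul]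
    push_cast
    rw [hR, Real.log_pow, Real.log_pow]
    push_cast
    field_simp

end Desco

/-! ### Existence of the block code -/

/-- Systematic Reed–Solomon codes correct all erasure bursts. -/
theorem exists_isBEBC (K B : ℕ) :
    ∃ (F : Type) (_ : Field F) (_ : Finite F) (H : Matrix (Fin K) (Fin B) F), IsBEBC H := by
  obtain ⟨p, hp, hprime⟩ := Nat.exists_infinite_primes (K + B)
  have : Fact p.Prime := ⟨hprime⟩
  have hcast : ∀ i j : ℕ, i < K + B → j < K + B → (i : ZMod p) = j → i = j := by
    intro i j hi hj h
    rw [ZMod.natCast_eq_natCast_iff', Nat.mod_eq_of_lt (by omega), Nat.mod_eq_of_lt (by omega)] at h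
    exact h
  have hinj : Set.InjOn (fun j : Fin K => ((j : ℕ) : ZMod p)) (Finset.univ : Finset (Fin K)) :=
    fun i _ j _ h => Fin.ext (hcast i j (by omega) (by omega) h)
  refine ⟨ZMod p, inferInstance, inferInstance, fun j k =>
    (Lagrange.basis Finset.univ (fun j : Fin K => ((j : ℕ) : ZMod p)) j).eval ((K + k : ℕ) : ZMod p),
    fun J m m' h => ?_⟩
  have heval : ∀ (m : Fin K → ZMod p) (i : Fin (K + B)),
      Fin.append m (Matrix.vecMul m fun j (k : Fin B) =>
        (Lagrange.basis Finset.univ (fun j : Fin K => ((j : ℕ) : ZMod p)) j).eval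
          ((K + k : ℕ) : ZMod p)) i =
      (Lagrange.interpolate Finset.univ (fun j : Fin K => ((j : ℕ) : ZMod p)) m).eval
        ((i : ℕ) : ZMod p) := by
    intro m i
    induction i using Fin.addCases with
    | left j =>
      rw [Fin.append_left, Fin.val_castAdd]
      exact (Lagrange.eval_interpolate_at_node m hinj (Finset.mem_univ j)).symm
    | right k =>
      rw [Fin.append_right, Fin.val_natAdd, Lagrange.interpolate_apply, Polynomial.eval_finsetSum]
      simp [Matrix.vecMul, dotProduct]
  simp only [heval] at h
  have hJ := J.isLt
  have hmod : ∀ r : Fin K, ((J : ℕ) + B + r) % (K + B) =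
      if (J : ℕ) + B + r < K + B then (J : ℕ) + B + r else (J : ℕ) + B + r - (K + B) := by
    intro r
    split_ifs with hr
    · exact Nat.mod_eq_of_lt hr
    · rw [Nat.mod_eq_sub_mod (by omega)]
      exact Nat.mod_eq_of_lt (by omega)
  -- The K surviving positions are J + B + r modulo K + B with r < K; two polynomials of degree
  -- below K agreeing there coincide.
  have hpoly := Polynomial.eq_of_degrees_lt_of_eval_index_eq (Finset.univ : Finset (Fin K))
    (v := fun r : Fin K => ((((J : ℕ) + B + r) % (K + B) : ℕ) : ZMod p))
    (f := Lagrange.interpolate Finset.univ (fun j : Fin K => ((j : ℕ) : ZMod p)) m)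
    (g := Lagrange.interpolate Finset.univ (fun j : Fin K => ((j : ℕ) : ZMod p)) m')
    ?_ (Lagrange.degree_interpolate_lt _ hinj) (Lagrange.degree_interpolate_lt _ hinj) ?_
  · funext j
    rw [← Lagrange.eval_interpolate_at_node m hinj (Finset.mem_univ j), hpoly,
      Lagrange.eval_interpolate_at_node m' hinj (Finset.mem_univ j)]
  · intro r _ r' _ hrr
    have h0 := hcast _ _ (Nat.mod_lt _ (by omega)) (Nat.mod_lt _ (by omega)) hrr
    rw [hmod, hmod] at h0
    apply Fin.ext
    split_ifs at h0 <;> omega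
  · intro r _
    refine h ⟨((J : ℕ) + B + r) % (K + B), Nat.mod_lt _ (by omega)⟩ ?_
    have h0 : (((J : ℕ) + B + r) % (K + B) + (K + B) - J) % (K + B) = B + r := by
      rw [hmod]
      split_ifs with hr
      · rw [show (J : ℕ) + B + r + (K + B) - J = B + r + (K + B) by omega, Nat.add_mod_right]
        exact Nat.mod_eq_of_lt (by omega)
      · rw [show (J : ℕ) + B + r - (K + B) + (K + B) - J = B + r by omega]
        exact Nat.mod_eq_of_lt (by omega)
    change B ≤ (((J : ℕ) + B + r) % (K + B) + (K + B) - J) % (K + B)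
    omega

/-! ### Arithmetic of the parameters and conclusion -/

theorem mainTheorem2 (α : ℚ) (a b B T B₂ : ℕ)
    (hα : 1 < α) (hb : 0 < b) (hab : α = (a : ℚ) / (b : ℚ)) (hcop : Nat.Coprime a b)
    (hB : 0 < B) (hBT : B ≤ T) (hB₂ : (B₂ : ℚ) = α * (B : ℚ)) :
    -- a DE-SCo exists, with delay `α T + B` (rounded up if it is not an integer) for user 2
    (∃ (S X : Type) (_ : Fintype S) (_ : Nonempty S) (_ : Fintype X) (c : StreamingCode S X),
      c.IsDESCo B T B₂ ⌈α * (T : ℚ) + (B : ℚ)⌉₊) ∧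
    -- if `α T` is an integer, the code with interleaving steps `b` and `a - b` is one
    ((∃ m : ℤ, α * (T : ℚ) = (m : ℚ)) →
      ∃ B₀ K : ℕ, B = b * B₀ ∧ T = b * (B₀ + K) ∧
        (∃ (F : Type) (_ : Field F) (_ : Finite F) (H : Matrix (Fin K) (Fin B₀) F), IsBEBC H) ∧
        ∀ (F : Type u) [Field F] [Finite F] (V : Type v) [AddCommGroup V] [Module F V]
          [Fintype V] [Nontrivial V] (H : Matrix (Fin K) (Fin B₀) F), IsBEBC H →
          ∀ T₂ : ℕ, (T₂ : ℚ) = α * (T : ℚ) + (B : ℚ) →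
            (desco (V := V) H a b).IsDESCo B T B₂ T₂) ∧
    -- in general, its source pseudo-expansion by the least `n` with `n α T` an integer is one
    (∃ n : ℕ, IsLeast {k : ℕ | 0 < k ∧ ∃ m : ℤ, (k : ℚ) * (α * (T : ℚ)) = (m : ℚ)} n ∧
      ∃ B₀ K : ℕ, n * B = b * B₀ ∧ n * T = b * (B₀ + K) ∧
        (∃ (F : Type) (_ : Field F) (_ : Finite F) (H : Matrix (Fin K) (Fin B₀) F), IsBEBC H) ∧
        ∀ (F : Type u) [Field F] [Finite F] (V : Type v) [AddCommGroup V] [Module F V]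
          [Fintype V] [Nontrivial V] (H : Matrix (Fin K) (Fin B₀) F), IsBEBC H →
            (pseudoExpand n (desco (V := V) H a b)).IsDESCo B T B₂
              ⌈α * (T : ℚ) + (B : ℚ)⌉₊) := by
  have hb' : (b : ℚ) ≠ 0 := by positivity
  have hba : b < a := by
    rw [hab, one_lt_div (by positivity)] at hα
    exact_mod_cast hα
  have hB₂' : b * B₂ = a * B := by
    rw [hab, div_mul_eq_mul_div, eq_div_iff hb'] at hB₂
    rw [mul_comm]
    exact_mod_cast hB₂
  have hint : ∀ k : ℕ, (∃ m : ℤ, (k : ℚ) * (α * (T : ℚ)) = (m : ℚ)) → b ∣ k * T := by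
    rintro k ⟨m, hm⟩
    have h1 : (a : ℤ) * (k * T : ℕ) = b * m := by
      rw [hab] at hm
      field_simp at hm
      have h2 : (a : ℚ) * (k * T : ℕ) = b * m := by
        push_cast
        linarith
      exact_mod_cast h2
    have h2 : (b : ℤ) ∣ (a : ℤ) * (k * T : ℕ) := ⟨m, h1⟩
    exact hcop.symm.dvd_of_dvd_mul_left (by exact_mod_cast h2)
  obtain ⟨B', rfl⟩ : b ∣ B := hcop.symm.dvd_of_dvd_mul_left ⟨B₂, hB₂'.symm⟩
  have hB' : 0 < B' := Nat.pos_of_mul_pos_left hB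
  obtain rfl : B₂ = a * B' := Nat.eq_of_mul_eq_mul_left hb (by rw [hB₂']; ring)
  have hsplit : ∀ k : ℕ, b ∣ k * T → ∃ K, k * T = b * (k * B' + K) := by
    rintro k ⟨T', hT'⟩
    have h1 : k * B' ≤ T' := by
      refine Nat.le_of_mul_le_mul_left (c := b) ?_ hb
      rw [← hT', Nat.mul_left_comm]
      exact Nat.mul_le_mul_left k hBT
    obtain ⟨K, rfl⟩ := Nat.exists_eq_add_of_le h1
    exact ⟨K, hT'⟩
  -- The denominator b itself clears αT.
  have hex : ∃ k : ℕ, 0 < k ∧ ∃ m : ℤ, (k : ℚ) * (α * (T : ℚ)) = (m : ℚ) :=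
    ⟨b, hb, a * T, by rw [hab]; push_cast; field_simp⟩
  classical
  set n := Nat.find hex with hn_def
  obtain ⟨hn, hnint⟩ := Nat.find_spec hex
  rw [← hn_def] at hn hnint
  obtain ⟨K, hK⟩ := hsplit n (hint n hnint)
  -- The left side equals n(αT + B) exactly; rounding up only relaxes the deadline.
  have hT₂ : a * (n * B' + K) + b * (n * B') ≤ n * ⌈α * (T : ℚ) + ((b * B' : ℕ) : ℚ)⌉₊ := by
    have h1 : ((a * (n * B' + K) + b * (n * B') : ℕ) : ℚ) =
        n * (α * (T : ℚ) + ((b * B' : ℕ) : ℚ)) := by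
      have h2 : (n : ℚ) * T = b * (n * B' + K) := by exact_mod_cast hK
      have h3 : (n : ℚ) * (α * T) = a * (n * B' + K) := by
        rw [mul_left_comm, h2, hab]
        field_simp
      push_cast
      linear_combination -h3
    have h4 := mul_le_mul_of_nonneg_left (Nat.le_ceil (α * (T : ℚ) + ((b * B' : ℕ) : ℚ)))
      (Nat.cast_nonneg (α := ℚ) n)
    rw [← h1] at h4
    exact_mod_cast h4
  refine ⟨?_, ?_, n, ⟨⟨hn, hnint⟩, fun k hk => Nat.find_min' hex hk⟩, n * B', K,
    Nat.mul_left_comm _ _ _, hK, exists_isBEBC _ _, ?_⟩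
  · obtain ⟨F, _, _, H, hH⟩ := exists_isBEBC K (n * B')
    have := Fintype.ofFinite F
    exact ⟨_, _, _, _, _, pseudoExpand n (desco (V := F) H a b),
      pseudoExpand_desco_isDESCo hn hb hba hB (Nat.mul_left_comm _ _ _) hK
        (Nat.mul_left_comm _ _ _) hT₂ hH⟩
  · rintro ⟨m, hm⟩
    obtain ⟨K₁, hK₁⟩ := hsplit 1 (hint 1 ⟨m, by rw [Nat.cast_one, one_mul, hm]⟩)
    rw [one_mul, one_mul] at hK₁
    refine ⟨B', K₁, rfl, hK₁, exists_isBEBC _ _, ?_⟩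
    intro F _ _ V _ _ _ _ H hH T₂ hT₂
    obtain rfl : T₂ = a * (B' + K₁) + b * B' := by
      rw [hab, hK₁] at hT₂
      push_cast at hT₂
      field_simp at hT₂
      exact_mod_cast hT₂
    rw [hK₁]
    exact desco_isDESCo hB' hb hba hH
  · intro F _ _ V _ _ _ _ H hH
    exact pseudoExpand_desco_isDESCo hn hb hba hB (Nat.mul_left_comm _ _ _) hK
      (Nat.mul_left_comm _ _ _) hT₂ hH
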